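/- Let $C(\mathbb{R})$ be the space of continuous functions $\mathbb{R}\to\mathbb{R}$ with the compact-open topology, and let $d_\infty(f,g)=\sup_{x\in\mathbb{R}}|f(x)-g(x)|\in[0,\infty]$. Let $E_\infty$ be the equivalence relation on $C(\mathbb{R})$ given by $f\,E_\infty\,g\iff d_\infty(f,g)<\infty$ (that is, $f-g$ is bounded), and let $\mathcal{V}$ be the uniformity on $C(\mathbb{R})$ with base $\{(f,g): d_\infty(f,g)<\varepsilon\}$, $\varepsilon>0$. Then the following hold. (i) $d_\infty$ is turbulent: every $E_\infty$-class is dense in $C(\mathbb{R})$; every $E_\infty$-class is meager in $C(\mathbb{R})$; and for every open $U\subset C(\mathbb{R})$, every $V\in\mathcal{V}$ with $V\subset E_\infty$ and every $f\in U$, the local equivalence class of $f$ (the set of all endpoints of finite chains $f=f_0,f_1,\dots,f_n$, $n\ge 0$, in $U$ with $(f_{i-1},f_i)\in V$ for $1\le i\le n$) is somewhere dense, i.e. its closure in $C(\mathbb{R})$ has non-empty interior. (ii) Let $S_\infty$ be the group of all permutations of $\mathbb{N}$ with the topology of pointwise convergence, and let $Y$ be a Polish $S_\infty$-space, i.e.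 a Polish space with a continuous action of $S_\infty$, with orbit equivalence relation $E^Y_{S_\infty}$. Then $E_\infty$ is generically $E^Y_{S_\infty}$-ergodic: for every map $\theta:C(\mathbb{R})\to Y$ such that $\theta^{-1}(O)$ has the Baire property for every open $O\subset Y$ and such that $f\,E_\infty\,g$ implies $\theta(f)\,E^Y_{S_\infty}\,\theta(g)$, there is a residual $E_\infty$-saturated set $C\subset C(\mathbb{R})$ such that $\theta(C)$ is contained in a single $S_\infty$-orbit. (iii) For every Polish group $G$ and every Polish space $Y$ with a continuous action of $G$, with orbit equivalence relation $E^Y_G$, $E_\infty$ is not Borel reducible to $E^Y_G$: there is no Borel map $\theta:C(\mathbb{R})\to Y$ such that $f\,E_\infty\,g\iff\theta(f)\,E^Y_G\,\theta(g)$ for all $f,g\in C(\mathbb{R})$. -/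

import Mathlib

open Set Filter Topology Uniformity
open scoped ENNReal

/-! ### Equivalence relations over topological spaces -/

/-- A map `θ` is `(E, F)`-invariant if `x E x'` implies `θ x F θ x'`. -/
def IsInvariantMap {X Y : Type*} (E : Setoid X) (F : Setoid Y) (θ : X → Y) : Prop :=
  ∀ x x' : X, E x x' → F (θ x) (θ x')

/-- A map is Borel if the preimage of every Borel set is a Borel set. -/
def IsBorelMap {X Y : Type*} [TopologicalSpace X] [TopologicalSpace Y] (θ : X → Y) : Prop :=
  @Measurable X Y (borel X) (borel Y) θ

/-- A map is Baire measurable if the preimage of every open set has the Baire property. -/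
def IsBaireMeasurableMap {X Y : Type*} [TopologicalSpace X] [TopologicalSpace Y]
    (θ : X → Y) : Prop :=
  ∀ U : Set Y, IsOpen U → BaireMeasurableSet (θ ⁻¹' U)

/-- `E ≤_B F`: there is an `(E, F)`-invariant Borel map `θ : X → Y` whose induced map
`X / E → Y / F` is injective. -/
def BorelReducible {X Y : Type*} [TopologicalSpace X] [TopologicalSpace Y]
    (E : Setoid X) (F : Setoid Y) : Prop :=
  ∃ θ : X → Y, IsBorelMap θ ∧
    ∃ hθ : IsInvariantMap E F θ, Function.Injective (Quotient.map (sa := E) (sb := F) θ hθ)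

/-- `E` is generically `F`-ergodic: for every `(E, F)`-invariant Baire measurable `θ : X → Y`
there is a residual `E`-saturated set `C` such that the map induced by `θ` from the `E`-classes
in `C` to the `F`-classes is constant. -/
def GenericallyErgodic {X Y : Type*} [TopologicalSpace X] [TopologicalSpace Y]
    (E : Setoid X) (F : Setoid Y) : Prop :=
  ∀ θ : X → Y, IsInvariantMap E F θ → IsBaireMeasurableMap θ →
    ∃ C : Set X, C ∈ residual X ∧ (∀ x ∈ C, ∀ x', E x x' → x' ∈ C) ∧
      ∀ x ∈ C, ∀ x' ∈ C, F (θ x) (θ x')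

/-- The group `S_∞` of all permutations of the natural numbers. -/
abbrev SInfty : Type := Equiv.Perm ℕ

/-- The topology of `S_∞`: the one induced by the product topology of `ℕ^ℕ`, where `ℕ` is
discrete. -/
instance SInfty.topologicalSpace : TopologicalSpace SInfty :=
  TopologicalSpace.induced (fun (g : SInfty) (n : ℕ) => g n) inferInstance

/-! ### Uniform relations, metric relations and turbulence -/

/-- A uniform equivalence relation over a set `X`: a uniformity on `X` together with an
equivalence relation over `X` that is one of its entourages. If `X` is also a topological space,
its topology need not be the one that the uniformity induces. -/
structure UniformRelation (X : Type*) where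
  /-- the uniformity -/
  uniformity : UniformSpace X
  /-- the equivalence relation -/
  rel : Setoid X
  /-- the equivalence relation is an entourage -/
  rel_mem : {p : X × X | rel p.1 p.2} ∈ 𝓤[uniformity]

/-- The local equivalence class `E(x, U, V)` of `x ∈ U`: the set of points that can be joined to
`x` by a finite (possibly trivial) chain of points of `U` whose consecutive terms are related
by `V`. -/
def localClass {X : Type*} (V : Set (X × X)) (U : Set X) (x : X) : Set X :=
  {y | Relation.ReflTransGen (fun a b => (a, b) ∈ V ∧ a ∈ U ∧ b ∈ U) x y}

/-- A uniform relation over a topological space is turbulent if every equivalence class is dense,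
every equivalence class is meager, and every local equivalence class is somewhere dense. -/
structure UniformRelation.IsTurbulent {X : Type*} [TopologicalSpace X]
    (R : UniformRelation X) : Prop where
  dense_class : ∀ x, Dense {y | R.rel x y}
  meagre_class : ∀ x, IsMeagre {y | R.rel x y}
  somewhere_dense_localClass :
    ∀ (U : Set X) (V : Set (X × X)), IsOpen U → V ∈ 𝓤[R.uniformity] →
      V ⊆ {p | R.rel p.1 p.2} → ∀ x ∈ U, (interior (closure (localClass V U x))).Nonempty

/-- The equivalence relation `E_d^X` of a metric `d` with possible infinite values:
`x` and `y` are equivalent if and only if `d(x, y) < ∞`. -/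
def EMetricSpace.finiteDistRel {X : Type*} (d : EMetricSpace X) : Setoid X where
  r x y := d.edist x y < ∞
  iseqv :=
    { refl := fun x => by rw [d.edist_self]; exact ENNReal.zero_lt_top
      symm := fun {x y} h => by rw [d.edist_comm]; exact h
      trans := fun {x y z} h h' =>
        lt_of_le_of_lt (d.edist_triangle x y z) (ENNReal.add_lt_top.2 ⟨h, h'⟩) }

/-- The uniform relation induced by a metric `d` with possible infinite values: the sets
`{(x, y) | d(x, y) < ε}`, `ε > 0`, form a base of the uniformity. -/
def EMetricSpace.toUniformRelation {X : Type*} (d : EMetricSpace X) : UniformRelation X where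
  uniformity := d.toUniformSpace
  rel := d.finiteDistRel
  rel_mem := by
    rw [d.uniformity_edist]
    exact mem_iInf_of_mem ∞ (mem_iInf_of_mem ENNReal.zero_lt_top (mem_principal_self _))

/-! ### The supremum metric relation -/

/-- The supremum metric `d_∞(f, g) = sup_{x ∈ ℝ} |f x - g x| ∈ [0, ∞]` on `C(ℝ)`. It is not an
instance: the topology of `C(ℝ)` remains the compact-open topology. -/
@[reducible]
noncomputable def supMetric : EMetricSpace C(ℝ, ℝ) where
  edist f g := ⨆ x : ℝ, ENNReal.ofReal |f x - g x|
  edist_self f := by simp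
  edist_comm f g := by simp only [abs_sub_comm]
  edist_triangle f g h := by
    refine iSup_le fun x => ?_
    calc ENNReal.ofReal |f x - h x| ≤ ENNReal.ofReal (|f x - g x| + |g x - h x|) :=
          ENNReal.ofReal_le_ofReal (abs_sub_le _ _ _)
      _ = ENNReal.ofReal |f x - g x| + ENNReal.ofReal |g x - h x| :=
          ENNReal.ofReal_add (abs_nonneg _) (abs_nonneg _)
      _ ≤ _ := add_le_add (le_iSup (fun y : ℝ => ENNReal.ofReal |f y - g y|) x)
          (le_iSup (fun y : ℝ => ENNReal.ofReal |g y - h y|) x)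
  eq_of_edist_eq_zero {f g} hfg := by
    ext x
    have h0 : ENNReal.ofReal |f x - g x| = 0 := ENNReal.iSup_eq_zero.1 hfg x
    have h1 : |f x - g x| ≤ 0 := ENNReal.ofReal_eq_zero.1 h0
    exact sub_eq_zero.1 (abs_nonpos_iff.1 h1)

/-! Turbulence is elementary. The compact-open topology sees only compact sets, so a function may be
altered freely near infinity: this makes every class dense, and it makes the closed set of functions
at distance at most n from f nowhere dense. Inside a convex neighbourhood, two functions at finite
distance are joined by a segment, which can be cut into steps as short as desired; hence a local
class contains the trace of a full class on an open set (`exists_subset_localClass_supMetric`).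

Generic ergodicity is Hjorth's argument. Category arguments on the acting group need it second
countable, and the bounded continuous functions with the sup norm are not; the separable Banach
space `C(EReal, ℝ)` replaces them. It still acts by bounded translations, with dense orbits. If θ is
a homomorphism to an orbit relation and W a neighbourhood of 1, then for generic x the generic small
translations of x move θ x by an element of W, locally uniformly in x
(`exists_residual_eventually_smul`). When W is an open subgroup, the steps along a subdivided
segment multiply to an element of W, however many they are (`exists_isOpen_forall_exists_smul`). A
back-and-forth construction then puts θ a and θ b in one orbit for any two generic a, b
(`exists_residual_forall_exists_smul`).

Non-reducibility to Polish group actions uses E₁, eventual equality of real sequences. E₁ reduces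
continuously to E_∞. A reduction of E₁ to an orbit relation is impossible: by the same local
control, the coordinates of a generic sequence can be changed one after another while the group
elements converge, so the limit has its image in the initial orbit although it differs from the
initial sequence everywhere. -/

/-! ### Baire category -/

section BaireCategory

variable {X H Y : Type*} [TopologicalSpace X] [TopologicalSpace H] [TopologicalSpace Y]

/-- One direction of the **Kuratowski–Ulam theorem**: almost every section of a residual set is
residual. -/
theorem eventually_residual_section [SecondCountableTopology H] {p : X × H → Prop}
    (hp : ∀ᶠ z in residual (X × H), p z) :
    ∀ᶠ x in residual X, ∀ᶠ h in residual H, p (x, h) := by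
  obtain ⟨S, hSo, hSd, hSc, hS⟩ := mem_residual_iff.1 hp
  have key : ∀ O ∈ S, ∀ᶠ x in residual X, ∀ᶠ h in residual H, (x, h) ∈ O := by
    intro O hO
    -- A section of O is dense once it meets every basic b. The points x whose section meets b form
    -- the projection of O ∩ (X × b), which is open and dense.
    have hb : ∀ b ∈ TopologicalSpace.countableBasis H,
        ∀ᶠ x in residual X, ∃ h ∈ b, (x, h) ∈ O := by
      intro b hb
      have hbo := TopologicalSpace.isOpen_of_mem_countableBasis hb
      have hbn := TopologicalSpace.nonempty_of_mem_countableBasis hb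
      have : {x : X | ∃ h ∈ b, (x, h) ∈ O} = Prod.fst '' (O ∩ univ ×ˢ b) := by
        ext x
        constructor
        · rintro ⟨h, h1, h2⟩
          exact ⟨(x, h), ⟨h2, mem_univ _, h1⟩, rfl⟩
        · rintro ⟨⟨x', h⟩, ⟨h2, -, h1⟩, rfl⟩
          exact ⟨h, h1, h2⟩
      refine residual_of_dense_open (s := {x : X | ∃ h ∈ b, (x, h) ∈ O}) ?_ ?_
      · rw [this]
        exact isOpenMap_fst _ ((hSo O hO).inter (isOpen_univ.prod hbo))
      · refine dense_iff_inter_open.2 fun U hU hUn => ?_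
        obtain ⟨⟨x, h⟩, ⟨hx, hh⟩, hz⟩ :=
          (hSd O hO).inter_open_nonempty _ (hU.prod hbo) (hUn.prod hbn)
        exact ⟨x, hx, h, hh, hz⟩
    have := (eventually_countable_ball (TopologicalSpace.countable_countableBasis H)).2 hb
    filter_upwards [this] with x hx
    refine residual_of_dense_open (s := {h | (x, h) ∈ O})
      ((hSo O hO).preimage (by fun_prop : Continuous fun h : H => (x, h))) ?_
    refine (TopologicalSpace.isBasis_countableBasis H).dense_iff.2 fun b hb _ => ?_
    obtain ⟨h, h1, h2⟩ := hx b hb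
    exact ⟨h, h1, h2⟩
  filter_upwards [(eventually_countable_ball hSc).2 key] with x hx
  filter_upwards [(eventually_countable_ball hSc).2 hx] with h hh
  exact hS (mem_sInter.2 hh)

/-- Every set has a Baire measurable hull. -/
theorem exists_baireMeasurableSet_hull [SecondCountableTopology X] (A : Set X) :
    ∃ B, BaireMeasurableSet B ∧ A ⊆ B ∧
      ∀ C, BaireMeasurableSet C → A ⊆ C → IsMeagre (B \ C) := by
  set S := {b ∈ TopologicalSpace.countableBasis X | IsMeagre (A ∩ b)} with hS
  have hSc : S.Countable := (TopologicalSpace.countable_countableBasis X).mono (sep_subset _ _)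
  have hUo : IsOpen (⋃₀ S) :=
    isOpen_sUnion fun b hb => TopologicalSpace.isOpen_of_mem_countableBasis hb.1
  have hAU : IsMeagre (A ∩ ⋃₀ S) := by
    rw [sUnion_eq_biUnion, inter_iUnion₂]
    exact isMeagre_biUnion hSc fun b hb => hb.2
  refine ⟨(⋃₀ S)ᶜ ∪ (A ∩ ⋃₀ S), hUo.baireMeasurableSet.compl.union hAU.baireMeasurableSet,
    fun x hx => ?_, fun C hC hAC => ?_⟩
  · by_cases h : x ∈ ⋃₀ S
    · exact Or.inr ⟨hx, h⟩
    · exact Or.inl h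
  · obtain ⟨O, hO, hCO⟩ := hC.compl.residualEq_isOpen
    have h1 : IsMeagre {x | ¬ (x ∈ Cᶜ ↔ x ∈ O)} := by
      have := eventuallyEq_set.1 hCO
      unfold IsMeagre
      filter_upwards [this] with x hx
      simpa using hx
    -- A avoids Cᶜ, so A is meagre in O and every basic set inside O belongs to S. Thus the hull
    -- loses O apart from a meagre part of A, and outside O the set Cᶜ is meagre.
    have hOU : O ⊆ ⋃₀ S := by
      intro x hx
      obtain ⟨b, hb, hxb, hbO⟩ :=
        (TopologicalSpace.isBasis_countableBasis X).exists_subset_of_mem_open hx hO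
      refine ⟨b, ⟨hb, h1.mono ?_⟩, hxb⟩
      rintro y ⟨hyA, hyb⟩ h
      exact h.2 (hbO hyb) (hAC hyA)
    refine (h1.union hAU).mono ?_
    rintro x ⟨hxB, hxC⟩
    by_cases hx : x ∈ O
    · rcases hxB with h | h
      · exact (h (hOU hx)).elim
      · exact Or.inr h
    · exact Or.inl fun h => hx (h.1 hxC)

/-- The preimage of an analytic set under a Baire measurable map has the Baire property. -/
theorem IsBaireMeasurableMap.preimage_analyticSet [SecondCountableTopology X] [T2Space Y]
    {θ : X → Y} (hθ : IsBaireMeasurableMap θ) {A : Set Y} (hA : MeasureTheory.AnalyticSet A) :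
    BaireMeasurableSet (θ ⁻¹' A) := by
  rw [MeasureTheory.AnalyticSet] at hA
  rcases hA with rfl | ⟨f, hf, rfl⟩
  · simpa using (isOpen_empty (X := X)).baireMeasurableSet
  -- Closure of the Baire property under the Souslin operation, with measurable hulls. `PiNat.res`
  -- lists the latest value first, so the one-step extensions of s are the lists `a :: s`.
  set N : List ℕ → Set (ℕ → ℕ) := fun s => {σ | PiNat.res σ s.length = s} with hN
  have hF : ∀ s, BaireMeasurableSet (θ ⁻¹' closure (f '' N s)) := fun s =>
    BaireMeasurableSet.of_compl (hθ _ isClosed_closure.isOpen_compl)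
  choose B hB hAB hBm using fun s => exists_baireMeasurableSet_hull (θ ⁻¹' (f '' N s))
  set C : List ℕ → Set X := fun s => B s ∩ θ ⁻¹' closure (f '' N s) with hC
  have hCm : ∀ s, BaireMeasurableSet (C s) := fun s => (hB s).inter (hF s)
  have hAC : ∀ s, θ ⁻¹' (f '' N s) ⊆ C s := fun s =>
    subset_inter (hAB s) (preimage_mono subset_closure)
  have hD : ∀ s, IsMeagre (C s \ ⋃ a, C (a :: s)) := by
    intro s
    refine (hBm s _ (.iUnion fun a => hCm (a :: s)) ?_).mono
      (sdiff_subset_sdiff_left inter_subset_left)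
    rintro x ⟨σ, hσ, hx⟩
    refine mem_iUnion.2 ⟨σ s.length, hAC _ ⟨σ, ?_, hx⟩⟩
    simp only [hN, mem_ofPred_eq, List.length_cons, PiNat.res_succ] at hσ ⊢
    rw [hσ]
  have hN0 : N [] = univ := by
    ext σ; simp [hN]
  -- A point outside the meagre exceptional sets can always be extended by one more value, hence
  -- follows a branch σ. Then θ x is in the closure of the image of every cylinder around σ, and
  -- continuity of f gives θ x = f σ.
  have hsub : C [] \ θ ⁻¹' range f ⊆ ⋃ s, C s \ ⋃ a, C (a :: s) := by
    rintro x ⟨hx, hxf⟩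
    by_contra hcon
    have hstep : ∀ s, ∃ a, x ∈ C s → x ∈ C (a :: s) := by
      intro s
      by_cases hs : x ∈ C s
      · have : x ∈ ⋃ a, C (a :: s) := by
          by_contra h
          exact hcon (mem_iUnion.2 ⟨s, hs, h⟩)
        obtain ⟨a, ha⟩ := mem_iUnion.1 this
        exact ⟨a, fun _ => ha⟩
      · exact ⟨0, fun h => (hs h).elim⟩
    choose a ha using hstep
    set l : ℕ → List ℕ := fun n => Nat.rec [] (fun _ s => a s :: s) n with hl
    have hl' : ∀ n, l (n + 1) = a (l n) :: l n := fun n => rfl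
    set σ : ℕ → ℕ := fun n => a (l n) with hσ
    have hres : ∀ n, PiNat.res σ n = l n := by
      intro n
      induction n with
      | zero => rfl
      | succ n ih => rw [PiNat.res_succ, ih, hl']
    have hmem : ∀ n, x ∈ C (l n) := by
      intro n
      induction n with
      | zero => exact hx
      | succ n ih => exact ha _ ih
    refine hxf ⟨σ, ?_⟩
    by_contra hne
    obtain ⟨u, v, hu, hv, hfu, hxv, huv⟩ := t2_separation hne
    obtain ⟨n, hn⟩ : ∃ n, PiNat.cylinder σ n ⊆ f ⁻¹' u :=
      by
        have := (PiNat.isTopologicalBasis_cylinders (fun _ : ℕ => ℕ)).exists_subset_of_mem_open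
          (show σ ∈ f ⁻¹' u from hfu) (hu.preimage hf)
        obtain ⟨_, ⟨τ, n, rfl⟩, h1, h2⟩ := this
        exact ⟨n, by rwa [PiNat.mem_cylinder_iff_eq.1 h1]⟩
    obtain ⟨y, hyv, τ, hτ, rfl⟩ := mem_closure_iff.1 (hmem n).2 v hv hxv
    refine disjoint_left.1 huv (hn ?_) hyv
    rw [PiNat.cylinder_eq_res]
    have hτ' : PiNat.res τ (l n).length = l n := hτ
    rwa [← hres, PiNat.res_length] at hτ'
  have : θ ⁻¹' range f = C [] \ (C [] \ θ ⁻¹' range f) := by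
    rw [sdiff_sdiff_cancel_left]
    have := hAC []
    rwa [hN0, image_univ] at this
  rw [this]
  exact (hCm []).diff ((isMeagre_iUnion hD).mono hsub).baireMeasurableSet

/-- A non-meagre set with the Baire property is comeagre in some nonempty open set. -/
theorem BaireMeasurableSet.exists_isOpen_of_not_isMeagre {B : Set X} (hB : BaireMeasurableSet B)
    (h : ¬ IsMeagre B) :
    ∃ O, IsOpen O ∧ O.Nonempty ∧ ∀ᶠ x in residual X, x ∈ O → x ∈ B := by
  obtain ⟨O, hO, hBO⟩ := hB.residualEq_isOpen
  refine ⟨O, hO, nonempty_iff_ne_empty.2 ?_, ?_⟩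
  · rintro rfl
    refine h ?_
    unfold IsMeagre
    filter_upwards [eventuallyEq_set.1 hBO] with x hx
    simpa using hx
  · filter_upwards [eventuallyEq_set.1 hBO] with x hx using hx.2

/-- The category quantifier preserves the Baire property. -/
theorem BaireMeasurableSet.setOf_eventually_section [SecondCountableTopology H] [BaireSpace H]
    {Q : Set (X × H)} (hQ : BaireMeasurableSet Q) {V : Set H} (hV : IsOpen V) :
    BaireMeasurableSet {x | ∀ᶠ h in residual H, h ∈ V → (x, h) ∈ Q} := by
  obtain ⟨O, hO, hQO⟩ := hQ.residualEq_isOpen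
  set S := {b ∈ TopologicalSpace.countableBasis H | (b ∩ V).Nonempty} with hS
  have hSc : S.Countable := (TopologicalSpace.countable_countableBasis H).mono (sep_subset _ _)
  -- An open section is comeagre in V exactly when it meets each basic set that meets V. This is a
  -- countable intersection of open conditions on x.
  have hG : BaireMeasurableSet (⋂ b ∈ S, {x | ∃ h ∈ b ∩ V, (x, h) ∈ O}) := by
    refine .biInter hSc fun b hb => IsOpen.baireMeasurableSet ?_
    have : {x : X | ∃ h ∈ b ∩ V, (x, h) ∈ O} = Prod.fst '' (O ∩ univ ×ˢ (b ∩ V)) := by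
      ext x
      constructor
      · rintro ⟨h, h1, h2⟩
        exact ⟨(x, h), ⟨h2, mem_univ _, h1⟩, rfl⟩
      · rintro ⟨⟨x', h⟩, ⟨h2, -, h1⟩, rfl⟩
        exact ⟨h, h1, h2⟩
    rw [this]
    exact isOpenMap_fst _ (hO.inter (isOpen_univ.prod
      ((TopologicalSpace.isOpen_of_mem_countableBasis hb.1).inter hV)))
  refine hG.congr (eventuallyEq_set.2 ?_)
  filter_upwards [eventually_residual_section (eventuallyEq_set.1 hQO)] with x hx
  simp only [mem_iInter, mem_ofPred_eq]
  constructor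
  · intro h
    have hd : ∀ᶠ k in residual H, k ∈ {k | (x, k) ∈ O} ∪ (closure V)ᶜ := by
      have hOx : IsOpen {k | (x, k) ∈ O} :=
        hO.preimage (by fun_prop : Continuous fun h : H => (x, h))
      refine residual_of_dense_open (hOx.union isClosed_closure.isOpen_compl) ?_
      refine (TopologicalSpace.isBasis_countableBasis H).dense_iff.2 fun b hb hbn => ?_
      by_cases hbV : (b ∩ V).Nonempty
      · obtain ⟨k, hk, hkO⟩ := h b ⟨hb, hbV⟩
        exact ⟨k, hk.1, Or.inl hkO⟩
      · obtain ⟨k, hk⟩ := hbn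
        refine ⟨k, hk, Or.inr fun hkV => hbV ?_⟩
        exact mem_closure_iff.1 hkV b (TopologicalSpace.isOpen_of_mem_countableBasis hb) hk
    filter_upwards [hx, hd] with k hk hk' hkV
    rcases hk' with h' | h'
    · exact hk.2 h'
    · exact (h' (subset_closure hkV)).elim
  · rintro h b ⟨hb, hbV⟩
    have hmem : {k | (x, k) ∈ O ∨ k ∉ V} ∈ residual H := by
      filter_upwards [hx, h] with k hk hk'
      by_cases hkV : k ∈ V
      · exact Or.inl (hk.1 (hk' hkV))
      · exact Or.inr hkV
    obtain ⟨k, hk, hk'⟩ := (dense_of_mem_residual hmem).inter_open_nonempty _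
      ((TopologicalSpace.isOpen_of_mem_countableBasis hb).inter hV) hbV
    exact ⟨k, hk, hk'.resolve_right fun h => h hk.2⟩

/-- A Baire measurable map to a second countable space is continuous on a residual set. -/
theorem IsBaireMeasurableMap.exists_residual_continuousOn [SecondCountableTopology Y]
    {θ : X → Y} (hθ : IsBaireMeasurableMap θ) : ∃ C ∈ residual X, ContinuousOn θ C := by
  choose! O hO hθO using fun U (hU : U ∈ TopologicalSpace.countableBasis Y) =>
    (hθ U (TopologicalSpace.isOpen_of_mem_countableBasis hU)).residualEq_isOpen
  -- The residual set consists of the points at which the preimage of each basic set agrees with its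
  -- open approximation.
  refine ⟨_, (eventually_countable_ball (TopologicalSpace.countable_countableBasis Y)).2
    fun U hU => eventuallyEq_set.1 (hθO U hU), ?_⟩
  intro x hx
  refine ((TopologicalSpace.isBasis_countableBasis Y).nhds_hasBasis).tendsto_right_iff.2 ?_
  rintro U ⟨hU, hxU⟩
  filter_upwards [self_mem_nhdsWithin,
    mem_nhdsWithin_of_mem_nhds ((hO U hU).mem_nhds ((hx U hU).1 hxU))] with y hy hyO
  exact (hy U hU).2 hyO

/-- Baire measurable maps pull back along open continuous maps. -/
theorem IsBaireMeasurableMap.comp_isOpenMap {θ : X → Y} (hθ : IsBaireMeasurableMap θ)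
    {m : H → X} (hm : Continuous m) (hm' : IsOpenMap m) : IsBaireMeasurableMap (θ ∘ m) :=
  fun U hU => (hθ U hU).preimage hm hm'

theorem IsBaireMeasurableMap.prodMk [SecondCountableTopology Y] {Z : Type*} [TopologicalSpace Z]
    [SecondCountableTopology Z] {θ : X → Y} {η : X → Z}
    (hθ : IsBaireMeasurableMap θ) (hη : IsBaireMeasurableMap η) :
    IsBaireMeasurableMap fun x => (θ x, η x) := by
  let _ : MeasurableSpace X := eventuallyMeasurableSpace (borel _) (residual _)
  borelize Y Z
  have h1 : Measurable θ := measurable_of_isOpen fun U hU => hθ U hU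
  have h2 : Measurable η := measurable_of_isOpen fun U hU => hη U hU
  intro U hU
  exact (h1.prodMk h2) hU.measurableSet

theorem IsBorelMap.isBaireMeasurableMap {θ : X → Y} (hθ : IsBorelMap θ) :
    IsBaireMeasurableMap θ := by
  intro U hU
  borelize X Y
  exact (hθ hU.measurableSet).baireMeasurableSet

end BaireCategory

/-! ### Generic local control of homomorphisms of orbit equivalence relations -/

section Translation

variable {X H : Type*} [AddCommGroup X] [TopologicalSpace X] [IsTopologicalAddGroup X]
  [AddCommGroup H] [TopologicalSpace H]

/-- The map is a projection after the shear homeomorphism (x, h) ↦ (x + ι h, h). Openness is what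
lets residual sets and Baire measurable maps on X be pulled back to X × H. -/
theorem isOpenMap_add_map (ι : H →+ X) (hι : Continuous ι) :
    IsOpenMap fun z : X × H => z.1 + ι z.2 := by
  let e : X × H ≃ₜ X × H :=
    { toFun := fun z => (z.1 + ι z.2, z.2)
      invFun := fun z => (z.1 - ι z.2, z.2)
      left_inv := fun z => by simp
      right_inv := fun z => by simp
      continuous_toFun := by fun_prop
      continuous_invFun := by fun_prop }
  exact isOpenMap_fst.comp e.isOpenMap

/-- Every residual set contains a residual set that is invariant under generic translations by
elements of countably many groups. -/
theorem exists_residual_subset_eventually_add_mem [SecondCountableTopology H] {I : Type*}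
    [Countable I] (ι : I → H →+ X) (hι : ∀ i, Continuous (ι i)) {C : Set X}
    (hC : C ∈ residual X) :
    ∃ C' ∈ residual X, C' ⊆ C ∧ ∀ x ∈ C', ∀ i, ∀ᶠ h in residual H, x + ι i h ∈ C' := by
  -- A single pass only sends generic translates back to C, not to the smaller set; the intersection
  -- of all the iterates is stable.
  set D : ℕ → Set X := fun n =>
    Nat.rec C (fun _ S => {x ∈ S | ∀ i, ∀ᶠ h in residual H, x + ι i h ∈ S}) n with hD
  have hD' : ∀ n, D (n + 1) = {x ∈ D n | ∀ i, ∀ᶠ h in residual H, x + ι i h ∈ D n} :=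
    fun n => rfl
  have hres : ∀ n, D n ∈ residual X := by
    intro n
    induction n with
    | zero => exact hC
    | succ n ih =>
      rw [hD']
      refine inter_mem ih (eventually_countable_forall.2 fun i => ?_)
      refine eventually_residual_section (p := fun z : X × H => z.1 + ι i z.2 ∈ D n) ?_
      exact tendsto_residual_of_isOpenMap (by have := hι i; fun_prop)
        (isOpenMap_add_map (ι i) (hι i)) ih
  refine ⟨⋂ n, D n, countable_iInter_mem.2 hres, iInter_subset D 0, fun x hx i => ?_⟩
  simp only [mem_iInter] at hx ⊢
  exact eventually_countable_forall.2 fun n => (hx (n + 1)).2 i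

end Translation

section LocalControl

variable {X H G Y : Type*} [AddCommGroup X] [TopologicalSpace X] [IsTopologicalAddGroup X]
  [SecondCountableTopology X] [BaireSpace X]
  [AddCommGroup H] [TopologicalSpace H] [IsTopologicalAddGroup H]
  [SecondCountableTopology H] [BaireSpace H]
  [Group G] [TopologicalSpace G] [IsTopologicalGroup G] [PolishSpace G]
  [TopologicalSpace Y] [PolishSpace Y] [MulAction G Y] [ContinuousSMul G Y]

omit [IsTopologicalGroup G] in
theorem analyticSet_setOf_exists_smul {W : Set G} (hW : IsOpen W) :
    MeasureTheory.AnalyticSet {p : Y × Y | ∃ g ∈ W, p.2 = g • p.1} := by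
  have : {p : Y × Y | ∃ g ∈ W, p.2 = g • p.1} =
      (fun q : G × Y => (q.2, q.1 • q.2)) '' (W ×ˢ univ) := by
    ext ⟨y, y'⟩
    constructor
    · rintro ⟨g, hg, h⟩
      exact ⟨(g, y), ⟨hg, mem_univ _⟩, by simp_all⟩
    · rintro ⟨⟨g, y''⟩, ⟨hg, -⟩, h⟩
      simp only [Prod.mk.injEq] at h
      obtain ⟨rfl, rfl⟩ := h
      exact ⟨g, hg, rfl⟩
  rw [this]
  exact (hW.prod isOpen_univ).analyticSet_image (by fun_prop)

variable (ι : H →+ X) (hι : Continuous ι) {θ : X → Y} (hθ : IsBaireMeasurableMap θ)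
include hι hθ

-- The relation "moved by an element of W" on Y is in general only analytic, so the Baire property
-- comes from `preimage_analyticSet`, applied to the pair (θ x, θ (x + ι h)).
omit [BaireSpace X] [IsTopologicalAddGroup H] [BaireSpace H] [IsTopologicalGroup G] in
theorem baireMeasurableSet_setOf_exists_smul {W : Set G} (hW : IsOpen W) :
    BaireMeasurableSet {z : X × H | ∃ g ∈ W, θ (z.1 + ι z.2) = g • θ z.1} :=
  ((hθ.comp_isOpenMap continuous_fst isOpenMap_fst).prodMk
    (hθ.comp_isOpenMap (by fun_prop) (isOpenMap_add_map ι hι))).preimage_analyticSet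
    (analyticSet_setOf_exists_smul hW)

/-- For a generic point `x`, generic small translations of `x` move `θ x` by an element of `W`. -/
theorem eventually_exists_eventually_smul (hinv : ∀ x h, ∃ g : G, θ (x + ι h) = g • θ x)
    {W : Set G} (hW : W ∈ 𝓝 1) (hWo : IsOpen W) :
    ∀ᶠ x in residual X, ∃ V ∈ TopologicalSpace.countableBasis H, 0 ∈ V ∧
      ∀ᶠ h in residual H, h ∈ V → ∃ g ∈ W, θ (x + ι h) = g • θ x := by
  set P : Set H → Set X :=
    fun V => {x | ∀ᶠ h in residual H, h ∈ V → ∃ g ∈ W, θ (x + ι h) = g • θ x} with hP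
  set B := {V ∈ TopologicalSpace.countableBasis H | (0 : H) ∈ V} with hB
  have hBc : B.Countable := (TopologicalSpace.countable_countableBasis H).mono (sep_subset _ _)
  have hgood : BaireMeasurableSet (⋃ V ∈ B, P V) := .biUnion hBc fun V hV =>
    (baireMeasurableSet_setOf_exists_smul ι hι hθ hWo).setOf_eventually_section
      (TopologicalSpace.isOpen_of_mem_countableBasis hV.1)
  suffices hm : IsMeagre (⋃ V ∈ B, P V)ᶜ by
    unfold IsMeagre at hm
    rw [compl_compl] at hm
    filter_upwards [hm] with x hx
    obtain ⟨V, hV, hx⟩ := mem_iUnion₂.1 hx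
    exact ⟨V, hV.1, hV.2, hx⟩
  by_contra hm
  obtain ⟨O, hO, hOn, hOP⟩ := hgood.compl.exists_isOpen_of_not_isMeagre hm
  obtain ⟨W', hW'o, hW'1, hW'⟩ : ∃ W' : Set G, IsOpen W' ∧ 1 ∈ W' ∧
      ∀ a ∈ W', ∀ b ∈ W', a * b⁻¹ ∈ W := by
    have hc : Tendsto (fun p : G × G => p.1 * p.2⁻¹) (𝓝 1 ×ˢ 𝓝 1) (𝓝 1) := by
      have : ContinuousAt (fun p : G × G => p.1 * p.2⁻¹) (1, 1) := by fun_prop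
      simpa [ContinuousAt, nhds_prod_eq] using this
    obtain ⟨U, ⟨hU1, hUo⟩, hU⟩ :=
      ((nhds_basis_opens (1 : G)).prod_self.tendsto_left_iff).1 hc W hW
    exact ⟨U, hUo, hU1, fun a ha b hb => hU (mk_mem_prod ha hb)⟩
  -- The right translates of W' by a dense sequence cover G, so for each x these countably many sets
  -- cover H, and one of them is non-meagre near 0.
  set A : ℕ → X → Set H := fun n x =>
    {h | ∃ g ∈ W', θ (x + ι h) = (g * TopologicalSpace.denseSeq G n) • θ x} with hA
  have hAm : ∀ᶠ x in residual X, ∀ n, BaireMeasurableSet (A n x) := by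
    refine eventually_countable_forall.2 fun n => ?_
    have hQ := baireMeasurableSet_setOf_exists_smul ι hι hθ
      (W := (· * (TopologicalSpace.denseSeq G n)⁻¹) ⁻¹' W')
      (hW'o.preimage (by fun_prop))
    obtain ⟨Q, hQo, hQ⟩ := hQ.residualEq_isOpen
    filter_upwards [eventually_residual_section (eventuallyEq_set.1 hQ)] with x hx
    have hQx : IsOpen {h | (x, h) ∈ Q} :=
      hQo.preimage (by fun_prop : Continuous fun h : H => (x, h))
    refine hQx.baireMeasurableSet.congr (eventuallyEq_set.2 ?_)
    filter_upwards [hx] with h hh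
    refine hh.symm.trans ⟨?_, ?_⟩
    · rintro ⟨g, hg, h1⟩
      exact ⟨_, hg, by simpa using h1⟩
    · rintro ⟨g, hg, h1⟩
      exact ⟨_, by simpa using hg, h1⟩
  have hA_cover : ∀ x h, ∃ n, h ∈ A n x := by
    intro x h
    obtain ⟨g, hg⟩ := hinv x h
    have hopen : IsOpen ((fun k => g * k⁻¹) ⁻¹' W') := hW'o.preimage (by fun_prop)
    obtain ⟨n, hn⟩ := (TopologicalSpace.denseRange_denseSeq G).exists_mem_open hopen
      ⟨g, by simpa using hW'1⟩
    exact ⟨n, _, hn, by simpa using hg⟩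
  have htrans : ∀ᶠ x in residual X, ∀ᶠ h in residual H,
      x + ι h ∈ O → x + ι h ∈ (⋃ V ∈ B, P V)ᶜ :=
    eventually_residual_section
      (p := fun z : X × H => z.1 + ι z.2 ∈ O → z.1 + ι z.2 ∈ (⋃ V ∈ B, P V)ᶜ)
      ((tendsto_residual_of_isOpenMap (by fun_prop) (isOpenMap_add_map ι hι)).eventually hOP)
  obtain ⟨x, hxO, hxA, hxt⟩ :=
    (dense_of_mem_residual (hAm.and htrans)).inter_open_nonempty O hO hOn
  set V₀ : Set H := {h | x + ι h ∈ O} with hV₀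
  have hV₀o : IsOpen V₀ := hO.preimage (by fun_prop)
  obtain ⟨n, hn⟩ : ∃ n, ¬ IsMeagre (A n x ∩ V₀) := by
    by_contra! hcon
    refine not_isMeagre_of_isOpen hV₀o ⟨0, by simpa [hV₀] using hxO⟩
      ((isMeagre_iUnion hcon).mono ?_)
    intro h hh
    obtain ⟨n, hn⟩ := hA_cover x h
    exact mem_iUnion.2 ⟨n, hn, hh⟩
  obtain ⟨O₁, hO₁, hO₁n, hO₁A⟩ :=
    ((hxA n).inter hV₀o.baireMeasurableSet).exists_isOpen_of_not_isMeagre hn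
  -- If A n x is comeagre in O₁ and h ∈ O₁ is generic, then h and generic h + k with k small both
  -- lie in A n x. The group elements they use differ by an element of W' W'⁻¹ ⊆ W, so x + ι h is
  -- good, although it was chosen bad.
  obtain ⟨h, hh, hhA, hht⟩ :=
    (dense_of_mem_residual (hO₁A.and hxt)).inter_open_nonempty O₁ hO₁ hO₁n
  obtain ⟨⟨a, ha, hxa⟩, hhO⟩ := hhA hh
  refine hht hhO ?_
  obtain ⟨b, hb, h0b, hbO⟩ := (TopologicalSpace.isBasis_countableBasis H).exists_subset_of_mem_open
    (show (0 : H) ∈ (fun k => h + k) ⁻¹' O₁ by simpa using hh) (hO₁.preimage (by fun_prop))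
  refine mem_iUnion₂.2 ⟨b, ⟨hb, h0b⟩, ?_⟩
  have hk := (tendsto_residual_of_isOpenMap (continuous_const_add h)
    (Homeomorph.addLeft h).isOpenMap).eventually hO₁A
  filter_upwards [hk] with k hk hkb
  obtain ⟨⟨c, hc, hxc⟩, -⟩ := hk (hbO hkb)
  refine ⟨c * a⁻¹, hW' c hc a ha, ?_⟩
  rw [hxa, add_assoc, ← map_add, hxc, smul_smul]
  group

/-- On a suitable residual set, the size of the translations that move `θ x` by elements of a
given neighbourhood `W` of the identity can be chosen locally uniformly. -/
theorem exists_residual_eventually_smul (hinv : ∀ x h, ∃ g : G, θ (x + ι h) = g • θ x) :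
    ∃ R ∈ residual X, ∀ x ∈ R, ∀ W ∈ 𝓝 (1 : G), ∃ V : Set H, IsOpen V ∧ 0 ∈ V ∧
      ∃ O ∈ 𝓝 x, ∀ y ∈ R, y ∈ O →
        ∀ᶠ h in residual H, h ∈ V → ∃ g ∈ W, θ (y + ι h) = g • θ y := by
  set P : Set G → Set H → Set X :=
    fun W V => {x | ∀ᶠ h in residual H, h ∈ V → ∃ g ∈ W, θ (x + ι h) = g • θ x} with hP
  set BG := {W ∈ TopologicalSpace.countableBasis G | (1 : G) ∈ W} with hBG
  have hBGc : BG.Countable := (TopologicalSpace.countable_countableBasis G).mono (sep_subset _ _)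
  have hBGo : ∀ W ∈ BG, IsOpen W := fun W hW =>
    TopologicalSpace.isOpen_of_mem_countableBasis hW.1
  choose! O hO hPO using fun W (hW : W ∈ BG) V (hV : V ∈ TopologicalSpace.countableBasis H) =>
    ((baireMeasurableSet_setOf_exists_smul ι hι hθ (hBGo W hW)).setOf_eventually_section
      (TopologicalSpace.isOpen_of_mem_countableBasis hV)).residualEq_isOpen
  have h1 := (eventually_countable_ball hBGc).2 fun W hW =>
    eventually_exists_eventually_smul ι hι hθ hinv ((hBGo W hW).mem_nhds hW.2) (hBGo W hW)
  have h2 := (eventually_countable_ball hBGc).2 fun W hW =>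
    (eventually_countable_ball (TopologicalSpace.countable_countableBasis H)).2 fun V hV =>
      eventuallyEq_set.1 (hPO W hW V hV)
  -- On R membership in each `P W V` agrees with membership in the open set `O W V`. Hence a V that
  -- works at x works at all nearby points of R.
  refine ⟨_, h1.and h2, ?_⟩
  rintro x ⟨hx1, hx2⟩ W hW
  obtain ⟨W', hW'b, hW'1, hW'⟩ :=
    ((TopologicalSpace.isBasis_countableBasis G).mem_nhds_iff).1 hW
  obtain ⟨V, hV, h0V, hxV⟩ := hx1 W' ⟨hW'b, hW'1⟩
  refine ⟨V, TopologicalSpace.isOpen_of_mem_countableBasis hV, h0V, O W' V,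
    (hO W' ⟨hW'b, hW'1⟩ V hV).mem_nhds ((hx2 W' ⟨hW'b, hW'1⟩ V hV).1 hxV), ?_⟩
  rintro y ⟨-, hy2⟩ hyO
  filter_upwards [(hy2 W' ⟨hW'b, hW'1⟩ V hV).2 hyO] with h hh hhV
  obtain ⟨g, hg, hgy⟩ := hh hhV
  exact ⟨g, hW' hg, hgy⟩

end LocalControl

/-! ### Generic ergodicity of dense translation actions -/

/-- Dependent choice with stage-dependent conditions; it drives both constructions of convergent
sequences of group elements below. -/
theorem exists_seq_of_forall_exists_step {α : Type*} (p : ℕ → α → Prop) (r : ℕ → α → α → Prop)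
    {a : α} (ha : p 0 a) (h : ∀ n x, p n x → ∃ y, p (n + 1) y ∧ r n x y) :
    ∃ f : ℕ → α, f 0 = a ∧ (∀ n, p n (f n)) ∧ ∀ n, r n (f n) (f (n + 1)) := by
  choose! s hs hr using h
  have hp : ∀ n, p n (Nat.rec a s n) := by
    intro n
    induction n with
    | zero => exact ha
    | succ n ih => exact hs n _ ih
  exact ⟨fun n => Nat.rec a s n, rfl, hp, fun n => hr n _ (hp n)⟩

section DenseTranslation

variable {X H G Y : Type*} [AddCommGroup X] [TopologicalSpace X] [IsTopologicalAddGroup X]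
  [Module ℝ X] [ContinuousSMul ℝ X] [LocallyConvexSpace ℝ X]
  [AddCommGroup H] [TopologicalSpace H] [BaireSpace H] [Module ℝ H] [ContinuousSMul ℝ H]
  [Group G] [TopologicalSpace G] [MulAction G Y]

/-- Points of a small neighbourhood `U` of `x` can be approximated by points `y` such that `θ y`
lies in the orbit of `θ x` under a given open subgroup. -/
theorem exists_isOpen_forall_exists_smul (ι : H →L[ℝ] X) (hι : DenseRange ι) {θ : X → Y}
    {C : Set X} (hC : ∀ x ∈ C, ∀ᶠ h in residual H, x + ι h ∈ C)
    (hCθ : ∀ x ∈ C, ∀ W ∈ 𝓝 (1 : G), ∃ V : Set H, IsOpen V ∧ 0 ∈ V ∧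
      ∃ O ∈ 𝓝 x, ∀ y ∈ C, y ∈ O →
        ∀ᶠ h in residual H, h ∈ V → ∃ g ∈ W, θ (y + ι h) = g • θ y)
    {x : X} (hx : x ∈ C) (W : OpenSubgroup G) :
    ∃ U, IsOpen U ∧ x ∈ U ∧ ∀ U', IsOpen U' → (U' ∩ U).Nonempty →
      ∃ y ∈ C, y ∈ U' ∩ U ∧ ∃ w ∈ W, θ y = w • θ x := by
  obtain ⟨V, hV, h0V, O, hO, hVO⟩ := hCθ x hx W (W.isOpen.mem_nhds W.one_mem)
  obtain ⟨K, ⟨hK, hKc⟩, hKO⟩ := (LocallyConvexSpace.convex_basis (𝕜 := ℝ) x).mem_iff.1 hO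
  have hUc : Convex ℝ (interior K) := hKc.interior
  have hxU : x ∈ interior K := mem_interior_iff_mem_nhds.2 hK
  refine ⟨interior K, isOpen_interior, hxU, fun U' hU' hne => ?_⟩
  set U := interior K with hU
  have hUo : IsOpen U := isOpen_interior
  set S : Set X := {y | y ∈ C ∧ y ∈ U ∧ ∃ w ∈ W, θ y = w • θ x} with hS
  -- Passing to the closure absorbs genericity: k itself need not be a good translation of a point
  -- of S, but nearby generic h are. The subgroup property of W keeps the accumulated element g * w
  -- in W.
  have hstep : ∀ k ∈ V, ∀ z ∈ closure S, z + ι k ∈ U → z + ι k ∈ closure S := by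
    intro k hk z hz hzU
    refine mem_closure_iff.2 fun N hN hzN => ?_
    have hcont : Continuous fun p : X × H => p.1 + ι p.2 := by fun_prop
    have hev : ∀ᶠ p : X × H in 𝓝 z ×ˢ 𝓝 k, p.1 + ι p.2 ∈ N ∩ U := by
      rw [← nhds_prod_eq]
      exact hcont.continuousAt.eventually ((hN.inter hUo).mem_nhds ⟨hzN, hzU⟩)
    obtain ⟨A, hA, B, hB, hAB⟩ := eventually_prod_iff.1 hev
    obtain ⟨y, hyA, hyC, hyU, w, hw, hyw⟩ := mem_closure_iff_nhds.1 hz _ hA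
    have hB' : interior {h | B h} ∩ V ∈ 𝓝 k :=
      inter_mem (interior_mem_nhds.2 hB) (hV.mem_nhds hk)
    obtain ⟨h, ⟨hhB, hhV⟩, hh1, hh2⟩ :=
      (dense_of_mem_residual ((hVO y hyC (hKO (interior_subset hyU))).and
        (hC y hyC))).inter_open_nonempty _ (isOpen_interior.inter hV) ⟨k, mem_of_mem_nhds hB'⟩
    obtain ⟨g, hg, hgy⟩ := hh1 hhV
    have hm := hAB (x := y) hyA (y := h) (interior_subset hhB)
    exact ⟨y + ι h, hm.1, hh2, hm.2, g * w, W.mul_mem hg hw, by rw [hgy, hyw, smul_smul]⟩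
  obtain ⟨h, hh⟩ := hι.exists_mem_open (s := (fun z => x + z) ⁻¹' (U' ∩ U))
    ((hU'.inter hUo).preimage (by fun_prop)) (by
      obtain ⟨u, hu⟩ := hne
      exact ⟨u - x, by simpa using hu⟩)
  -- The segment from x to x + ι h is walked in N + 1 equal steps, each in V; convexity keeps it
  -- inside U.
  obtain ⟨N, hN⟩ : ∃ N : ℕ, ((N + 1 : ℝ)⁻¹) • h ∈ V := by
    have ht : Tendsto (fun N : ℕ => ((N + 1 : ℝ)⁻¹) • h) atTop (𝓝 ((0 : ℝ) • h)) := by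
      have := (tendsto_one_div_add_atTop_nhds_zero_nat (𝕜 := ℝ)).smul_const h
      simpa using this
    rw [zero_smul] at ht
    exact (ht.eventually (hV.mem_nhds h0V)).exists
  have hpos : (0 : ℝ) < N + 1 := by positivity
  have hseg : ∀ j : ℕ, j ≤ N + 1 → x + ι (((j : ℝ) * (N + 1 : ℝ)⁻¹) • h) ∈ U := by
    intro j hj
    have ht0 : 0 ≤ (j : ℝ) * (N + 1 : ℝ)⁻¹ := by positivity
    have ht1 : (j : ℝ) * (N + 1 : ℝ)⁻¹ ≤ 1 := by
      rw [mul_inv_le_iff₀ hpos, one_mul]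
      exact_mod_cast hj
    have := hUc.add_smul_sub_mem hxU hh.2 ⟨ht0, ht1⟩
    simpa using this
  have hind : ∀ j : ℕ, j ≤ N + 1 → x + ι (((j : ℝ) * (N + 1 : ℝ)⁻¹) • h) ∈ closure S := by
    intro j
    induction j with
    | zero =>
      intro _
      refine subset_closure ?_
      simpa using ⟨hx, hxU, 1, W.one_mem, (one_smul G (θ x)).symm⟩
    | succ j ih =>
      intro hj
      have h1 := hstep _ hN _ (ih (by omega))
      have heq : x + ι (((j : ℝ) * (N + 1 : ℝ)⁻¹) • h) + ι ((N + 1 : ℝ)⁻¹ • h) =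
          x + ι ((((j + 1 : ℕ) : ℝ) * (N + 1 : ℝ)⁻¹) • h) := by
        rw [add_assoc, ← map_add, ← add_smul]
        push_cast
        ring_nf
      rw [heq] at h1
      exact h1 (hseg _ hj)
  have hfin := hind (N + 1) le_rfl
  have h1 : (((N + 1 : ℕ) : ℝ) * (N + 1 : ℝ)⁻¹) = 1 := by
    push_cast
    exact mul_inv_cancel₀ hpos.ne'
  rw [h1, one_smul] at hfin
  obtain ⟨y, hyU', hyC, hyU, hw⟩ := mem_closure_iff.1 hfin U' hU' hh.1
  exact ⟨y, hyC, ⟨hyU', hyU⟩, hw⟩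

variable [SecondCountableTopology X] [BaireSpace X] [IsTopologicalAddGroup H]
  [SecondCountableTopology H] [PolishSpace G] [NonarchimedeanGroup G]
  [TopologicalSpace Y] [PolishSpace Y] [ContinuousSMul G Y]

/-- **Hjorth's turbulence theorem** for dense translation actions of topological vector spaces
on locally convex spaces, and actions of non-archimedean Polish groups. -/
theorem exists_residual_forall_exists_smul (ι : H →L[ℝ] X) (hι : DenseRange ι) {θ : X → Y}
    (hθ : IsBaireMeasurableMap θ) (hinv : ∀ x h, ∃ g : G, θ (x + ι h) = g • θ x) :
    ∃ C ∈ residual X, ∀ x ∈ C, ∀ y ∈ C, ∃ g : G, θ y = g • θ x := by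
  obtain ⟨R, hR, hRθ⟩ := exists_residual_eventually_smul (G := G) (ι : H →+ X)
    ι.continuous hθ hinv
  obtain ⟨D, hD, hDθ⟩ := hθ.exists_residual_continuousOn
  obtain ⟨C, hCr, hCsub, hC⟩ := exists_residual_subset_eventually_add_mem
    (fun _ : Unit => (ι : H →+ X)) (fun _ => ι.continuous) (inter_mem hR hD)
  replace hC : ∀ x ∈ C, ∀ᶠ h in residual H, x + ι h ∈ C := fun x hx => hC x hx ()
  have hCθ : ContinuousOn θ C := hDθ.mono fun x hx => (hCsub hx).2
  let _ := TopologicalSpace.upgradeIsCompletelyMetrizable G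
  let _ := TopologicalSpace.metrizableSpaceMetric Y
  refine ⟨C, hCr, fun a ha b hb => ?_⟩
  -- As long as later choices stay in U, they can be made at points that θ sends into the orbit of θ
  -- c, by a group element that has moved less than 2⁻ⁿ from g.
  set L : ℕ → X → G → Set X → Prop := fun n c g U => IsOpen U ∧
    ∀ U', IsOpen U' → (U' ∩ U).Nonempty →
      ∃ y ∈ C, y ∈ U' ∩ U ∧ ∃ g', θ y = g' • θ c ∧ dist g g' < (1 / 2 : ℝ) ^ n with hL
  have hLex : ∀ n c g p, p ∈ C → θ p = g • θ c → ∃ U, p ∈ U ∧ L n c g U := by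
    intro n c g p hp hpc
    -- The complete metric on G need not be invariant, so the open subgroup is chosen depending on
    -- g.
    have hN : {w : G | dist g (w * g) < (1 / 2 : ℝ) ^ n} ∈ 𝓝 (1 : G) := by
      refine IsOpen.mem_nhds (isOpen_lt (by fun_prop) continuous_const) ?_
      simp
    obtain ⟨W, hW⟩ := NonarchimedeanGroup.is_nonarchimedean _ hN
    obtain ⟨U, hUo, hpU, hU⟩ := exists_isOpen_forall_exists_smul ι hι hC
      (fun x hx W hW => by
        obtain ⟨V, hV, h0, O, hO, h⟩ := hRθ x (hCsub hx).1 W hW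
        exact ⟨V, hV, h0, O, hO, fun y hy hyO => h y (hCsub hy).1 hyO⟩) hp W
    refine ⟨U, hpU, hUo, fun U' hU' hne => ?_⟩
    obtain ⟨y, hy, hyU, w, hw, hyw⟩ := hU U' hU' hne
    exact ⟨y, hy, hyU, w * g, by rw [hyw, hpc, smul_smul], hW hw⟩
  -- In a state (p, g, k, U, V) the point p is reached exactly from a, by g. On the side of b only
  -- membership in V ties p to k.
  set Inv : ℕ → X × G × G × Set X × Set X → Prop := fun n s =>
    s.1 ∈ C ∧ s.1 ∈ s.2.2.2.1 ∧ s.1 ∈ s.2.2.2.2 ∧ θ s.1 = s.2.1 • θ a ∧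
      L n a s.2.1 s.2.2.2.1 ∧ L n b s.2.2.1 s.2.2.2.2 with hInv
  set Rel : ℕ → X × G × G × Set X × Set X → X × G × G × Set X × Set X → Prop := fun n s t =>
    dist s.2.1 t.2.1 < (1 / 2 : ℝ) ^ n ∧ dist s.2.2.1 t.2.2.1 < (1 / 2 : ℝ) ^ n ∧
      dist (t.2.2.1 • θ b) (s.2.1 • θ a) < (1 / 2 : ℝ) ^ n with hRel
  obtain ⟨s₀, hs₀⟩ : ∃ s, Inv 0 s := by
    obtain ⟨U₀, haU₀, hU₀⟩ := hLex 0 a 1 a ha (one_smul _ _).symm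
    obtain ⟨h₀, hh₀⟩ := hι.exists_mem_open (s := (fun z => b + z) ⁻¹' U₀)
      (hU₀.1.preimage (by fun_prop)) ⟨a - b, by simpa using haU₀⟩
    obtain ⟨h, hh, hhC⟩ := (dense_of_mem_residual (hC b hb)).inter_open_nonempty
      {h | b + ι h ∈ U₀} (hU₀.1.preimage (by fun_prop)) ⟨h₀, hh₀⟩
    obtain ⟨k, hk⟩ := hinv b h
    obtain ⟨V, hqV, hV⟩ := hLex 0 b k (b + ι h) hhC hk
    obtain ⟨p, hpC, hp, g, hpg, -⟩ := hU₀.2 V hV.1 ⟨_, hqV, hh⟩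
    obtain ⟨U, hpU, hU⟩ := hLex 0 a g p hpC hpg
    exact ⟨(p, g, k, U, V), hpC, hpU, hp.1, hpg, hU, hV⟩
  obtain ⟨f, -, hf, hfr⟩ := exists_seq_of_forall_exists_step Inv Rel hs₀ (by
    rintro n ⟨p, g, k, U, V⟩ ⟨hpC, hpU, hpV, hpg, hU, hV⟩
    dsimp only at hpC hpU hpV hpg hU hV
    have hnear : ∀ᶠ z in 𝓝[C] p, dist (θ z) (θ p) < (1 / 2 : ℝ) ^ n :=
      (hCθ p hpC).eventually (Metric.ball_mem_nhds _ (by positivity))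
    obtain ⟨O, hO, hpO, hOn⟩ := mem_nhdsWithin.1 hnear
    -- Back and forth: q is reached from b, so close to p that θ q is near θ p, and then p' is
    -- reached from a inside the new V'. The last clause of `Rel` is the distance from θ q to θ p;
    -- it forces the two limits to coincide.
    obtain ⟨q, hqC, ⟨⟨hqU, hqO⟩, hqV⟩, k', hqk, hkk'⟩ :=
      hV.2 (U ∩ O) (hU.1.inter hO) ⟨p, ⟨hpU, hpO⟩, hpV⟩
    obtain ⟨V', hqV', hV'⟩ := hLex (n + 1) b k' q hqC hqk
    obtain ⟨p', hp'C, ⟨hp'V', hp'U⟩, g', hp'g, hgg'⟩ := hU.2 V' hV'.1 ⟨q, hqV', hqU⟩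
    obtain ⟨U', hp'U', hU'⟩ := hLex (n + 1) a g' p' hp'C hp'g
    refine ⟨(p', g', k', U', V'), ⟨hp'C, hp'U', hp'V', hp'g, hU', hV'⟩, hgg', hkk', ?_⟩
    have := hOn ⟨hqO, hqC⟩
    simpa [hqk, hpg] using this)
  obtain ⟨g, hg⟩ := cauchySeq_tendsto_of_complete (cauchySeq_of_le_geometric (1 / 2 : ℝ) 1
    (by norm_num) (f := fun n => (f n).2.1) fun n => by simpa using (hfr n).1.le)
  obtain ⟨k, hk⟩ := cauchySeq_tendsto_of_complete (cauchySeq_of_le_geometric (1 / 2 : ℝ) 1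
    (by norm_num) (f := fun n => (f n).2.2.1) fun n => by simpa using (hfr n).2.1.le)
  have hlim : k • θ b = g • θ a := by
    have h1 : Tendsto (fun n => (f (n + 1)).2.2.1 • θ b) atTop (𝓝 (k • θ b)) :=
      (hk.comp (tendsto_add_atTop_nat 1)).smul_const _
    have h2 : Tendsto (fun n => (f n).2.1 • θ a) atTop (𝓝 (g • θ a)) := hg.smul_const _
    have h3 := h1.dist h2
    have h4 : Tendsto (fun n => dist ((f (n + 1)).2.2.1 • θ b) ((f n).2.1 • θ a)) atTop (𝓝 0) :=
      squeeze_zero (fun _ => dist_nonneg) (fun n => (hfr n).2.2.le)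
        (tendsto_pow_atTop_nhds_zero_of_lt_one (by norm_num) (by norm_num))
    exact dist_eq_zero.1 (tendsto_nhds_unique h3 h4)
  exact ⟨k⁻¹ * g, by rw [mul_smul, ← hlim, inv_smul_smul]⟩

end DenseTranslation

/-! ### The permutation group of the natural numbers -/

namespace SInfty

theorem continuous_apply (n : ℕ) : Continuous fun g : SInfty => g n :=
  (_root_.continuous_apply n).comp continuous_induced_dom

theorem continuous_iff {Z : Type*} [TopologicalSpace Z] {f : Z → SInfty} :
    Continuous f ↔ ∀ n, Continuous fun z => f z n :=
  continuous_induced_rng.trans continuous_pi_iff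

instance : IsTopologicalGroup SInfty where
  continuous_mul := continuous_iff.2 fun n => by
    have h : Continuous fun p : SInfty × ℕ => p.1 p.2 :=
      continuous_prod_of_discrete_right.2 continuous_apply
    exact h.comp (continuous_fst.prodMk ((continuous_apply n).comp continuous_snd))
  continuous_inv := continuous_iff.2 fun n => by
    refine continuous_discrete_rng.2 fun m => ?_
    have : (fun g : SInfty => g⁻¹ n) ⁻¹' {m} = (fun g : SInfty => g m) ⁻¹' {n} := by
      ext g
      simp only [mem_preimage, mem_singleton_iff, Equiv.Perm.inv_eq_iff_eq]
      exact eq_comm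
    rw [this]
    exact (isOpen_discrete _).preimage (continuous_apply m)

/-- The permutations are not closed in ℕ^ℕ, since a limit may fail to be surjective. Recording the
inverse as well gives a closed embedding, because being mutually inverse is a closed condition. -/
instance : PolishSpace SInfty := by
  set e : SInfty → (ℕ → ℕ) × (ℕ → ℕ) := fun g => (fun n => g n, fun n => g⁻¹ n) with he
  have hc : Continuous e := (continuous_pi continuous_apply).prodMk
    (continuous_pi fun n => (continuous_apply n).comp continuous_inv)
  have hi : IsInducing e := IsInducing.of_comp hc continuous_fst ⟨rfl⟩
  have hinj : Function.Injective e := fun g h hgh => by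
    ext n
    exact congrFun (congrArg Prod.fst hgh) n
  have hcomp : ∀ n, Continuous fun p : (ℕ → ℕ) × (ℕ → ℕ) => p.1 (p.2 n) := fun n => by
    have h : Continuous fun p : (ℕ → ℕ) × ℕ => p.1 p.2 :=
      continuous_prod_of_discrete_right.2 fun n => _root_.continuous_apply n
    exact h.comp (continuous_fst.prodMk ((_root_.continuous_apply n).comp continuous_snd))
  have hr : range e = {p | ∀ n, p.1 (p.2 n) = n} ∩ {p | ∀ n, p.2 (p.1 n) = n} := by
    ext ⟨a, b⟩
    constructor
    · rintro ⟨g, hg⟩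
      simp only [he, Prod.mk.injEq] at hg
      obtain ⟨rfl, rfl⟩ := hg
      exact ⟨fun n => by simp, fun n => by simp⟩
    · rintro ⟨h1, h2⟩
      exact ⟨⟨a, b, h2, h1⟩, rfl⟩
  have hcl : IsClosed (range e) := by
    rw [hr]
    refine IsClosed.inter ?_ ?_
    · simp only [ofPred_forall]
      exact isClosed_iInter fun n => isClosed_eq (hcomp n) continuous_const
    · simp only [ofPred_forall]
      exact isClosed_iInter fun n =>
        isClosed_eq ((hcomp n).comp continuous_swap) continuous_const
  exact (IsClosedEmbedding.mk ⟨hi, hinj⟩ hcl).polishSpace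

/-- The pointwise stabilizers of the initial segments of ℕ are open subgroups and form a base at 1.
-/
instance : NonarchimedeanGroup SInfty where
  is_nonarchimedean U hU := by
    rw [nhds_induced, mem_comap] at hU
    obtain ⟨V, hV, hVU⟩ := hU
    obtain ⟨_, ⟨τ, n, rfl⟩, h1, h2⟩ :=
      ((PiNat.isTopologicalBasis_cylinders (fun _ : ℕ => ℕ)).mem_nhds_iff).1 hV
    rw [← PiNat.mem_cylinder_iff_eq.1 h1] at h2
    refine ⟨⟨fixingSubgroup SInfty (Iio n), ?_⟩, fun g hg => hVU (h2 fun i hi => ?_)⟩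
    · have : (fixingSubgroup SInfty (Iio n)).carrier =
          ⋂ i ∈ Iio n, (fun g : SInfty => g i) ⁻¹' {i} := by
        ext g
        simp [mem_fixingSubgroup_iff]
      rw [this]
      exact (finite_Iio n).isOpen_biInter fun i _ =>
        (isOpen_discrete _).preimage (continuous_apply i)
    · exact (mem_fixingSubgroup_iff SInfty).1 hg i hi

end SInfty

/-! ### Eventual equality of sequences is not reducible to an orbit equivalence relation -/

section EventualEquality

variable {G Y : Type*} [Group G] [TopologicalSpace G] [IsTopologicalGroup G] [PolishSpace G]
  [TopologicalSpace Y] [PolishSpace Y] [MulAction G Y] [ContinuousSMul G Y]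

/-- A Baire measurable map cannot reduce the eventual equality of real sequences (the equivalence
relation `E₁`) to the orbit equivalence relation of a Polish group (Kechris–Louveau). -/
theorem IsBaireMeasurableMap.not_forall_eventuallyEq_iff_exists_smul {θ : (ℕ → ℝ) → Y}
    (hθ : IsBaireMeasurableMap θ) :
    ¬ ∀ x y : ℕ → ℝ, x =ᶠ[atTop] y ↔ ∃ g : G, θ y = g • θ x := by
  intro hred
  set ι : ℕ → ℝ →+ (ℕ → ℝ) := fun n => AddMonoidHom.single (fun _ : ℕ => ℝ) n with hι
  have hιn : ∀ (n m : ℕ) (h : ℝ), m ≠ n → ι n h m = 0 := fun n m h hmn => by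
    simp [hι, AddMonoidHom.single_apply, hmn]
  have hιs : ∀ (n : ℕ) (h : ℝ), ι n h n = h := fun n h => by
    simp [hι, AddMonoidHom.single_apply]
  have hιc : ∀ n, Continuous (ι n) := fun n => continuous_pi fun m => by
    rcases eq_or_ne m n with rfl | hmn
    · simp only [hιs]
      exact continuous_id
    · simp only [hιn n m _ hmn]
      exact continuous_const
  have hinv : ∀ n x h, ∃ g : G, θ (x + ι n h) = g • θ x := fun n x h => by
    refine (hred _ _).1 ?_
    filter_upwards [eventually_gt_atTop n] with m hm
    simp [hιn n m h hm.ne']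
  choose R hR hRθ using fun n => exists_residual_eventually_smul (ι n) (hιc n) hθ (hinv n)
  obtain ⟨D, hD, hDθ⟩ := hθ.exists_residual_continuousOn
  -- The limit of the construction must lie where θ is continuous. A dense Gδ set T allows this to
  -- be arranged: stage n confines the rest of the sequence to a closed set inside the n-th open
  -- set.
  obtain ⟨T, hTsub, hTG, hTd⟩ := mem_residual.1 (inter_mem hD (countable_iInter_mem.2 hR))
  obtain ⟨O, hO, hTO⟩ := isGδ_iff_eq_iInter_nat.1 hTG
  obtain ⟨C, hCr, hCT, hC⟩ := exists_residual_subset_eventually_add_mem ι hιc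
    (residual_of_dense_Gδ hTG hTd)
  obtain ⟨x₀, hx₀⟩ := (dense_of_mem_residual hCr).nonempty
  let _ := TopologicalSpace.upgradeIsCompletelyMetrizable G
  -- Step n changes the coordinate n and no other, by a nonzero amount so small that the group
  -- element moves less than 2⁻ⁿ.
  obtain ⟨f, hf0, hf, hfr⟩ := exists_seq_of_forall_exists_step
    (fun (_ : ℕ) (s : (ℕ → ℝ) × G × Set (ℕ → ℝ)) =>
      s.1 ∈ C ∧ θ s.1 = s.2.1 • θ x₀ ∧ IsClosed s.2.2 ∧ s.2.2 ∈ 𝓝 s.1)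
    (fun n s t => t.2.2 ⊆ s.2.2 ∧ t.2.2 ⊆ O n ∧ dist s.2.1 t.2.1 < (1 / 2 : ℝ) ^ n ∧
      t.1 n ≠ s.1 n ∧ ∀ m ≠ n, t.1 m = s.1 m)
    (a := (x₀, 1, univ)) ⟨hx₀, (one_smul _ _).symm, isClosed_univ, univ_mem⟩ (by
    rintro n ⟨x, g, F⟩ ⟨hxC, hxg, -, hFx⟩
    dsimp only at hxC hxg hFx
    have hN : {w : G | dist g (w * g) < (1 / 2 : ℝ) ^ n} ∈ 𝓝 (1 : G) := by
      refine IsOpen.mem_nhds (isOpen_lt (by fun_prop) continuous_const) ?_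
      simp
    have hxR : x ∈ R n := mem_iInter.1 (hTsub (hCT hxC)).2 n
    obtain ⟨V, hV, h0V, O', hO', hVO⟩ := hRθ n x hxR _ hN
    have hcont : Continuous fun h : ℝ => x + ι n h := by
      have := hιc n
      fun_prop
    have hopen : IsOpen ((V ∩ {h | x + ι n h ∈ interior F}) ∩ {0}ᶜ) :=
      (hV.inter (isOpen_interior.preimage hcont)).inter isOpen_compl_singleton
    have hne : ((V ∩ {h | x + ι n h ∈ interior F}) ∩ {0}ᶜ).Nonempty := by
      have h0 : V ∩ {h | x + ι n h ∈ interior F} ∈ 𝓝 (0 : ℝ) := by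
        refine (hV.inter (isOpen_interior.preimage hcont)).mem_nhds ⟨h0V, ?_⟩
        simpa using mem_interior_iff_mem_nhds.2 hFx
      exact nonempty_of_mem (inter_mem (mem_nhdsWithin_of_mem_nhds h0) self_mem_nhdsWithin)
    obtain ⟨h, ⟨⟨hhV, hhF⟩, hh0⟩, hh1, hh2⟩ :=
      (dense_of_mem_residual ((hVO x hxR (mem_of_mem_nhds hO')).and
        (hC x hxC n))).inter_open_nonempty _ hopen hne
    obtain ⟨w, hw, hwx⟩ := hh1 hhV
    have hmem : O n ∩ interior F ∈ 𝓝 (x + ι n h) := by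
      refine ((hO n).inter isOpen_interior).mem_nhds ⟨?_, hhF⟩
      have := hCT hh2
      rw [hTO] at this
      exact mem_iInter.1 this n
    obtain ⟨F', hF', hF'c, hF'sub⟩ := exists_mem_nhds_isClosed_subset hmem
    refine ⟨(x + ι n h, w * g, F'), ⟨hh2, by rw [hwx, hxg, smul_smul], hF'c, hF'⟩,
      fun z hz => interior_subset (hF'sub hz).2, fun z hz => (hF'sub hz).1, hw, ?_, ?_⟩
    · simpa [hιs] using hh0
    · intro m hm
      simp [hιn n m h hm])
  have hconst : ∀ k m, k + 1 ≤ m → (f m).1 k = (f (k + 1)).1 k := by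
    intro k m hm
    induction m, hm using Nat.le_induction with
    | base => rfl
    | succ m hm ih => rw [(hfr m).2.2.2.2 k (by omega), ih]
  have hinit : ∀ k m, m ≤ k → (f m).1 k = x₀ k := by
    intro k m
    induction m with
    | zero => intro _; rw [hf0]
    | succ m ih => intro hm; rw [(hfr m).2.2.2.2 k (by omega), ih (by omega)]
  set z : ℕ → ℝ := fun k => (f (k + 1)).1 k with hz
  have hlim : Tendsto (fun n => (f n).1) atTop (𝓝 z) :=
    tendsto_pi_nhds.2 fun k => tendsto_atTop_of_eventually_const (hconst k)
  have hanti : Antitone fun n => (f n).2.2 := antitone_nat_of_succ_le fun n => (hfr n).1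
  have hzF : ∀ n, z ∈ (f n).2.2 := fun n => by
    refine (hf n).2.2.1.mem_of_tendsto hlim ?_
    filter_upwards [eventually_ge_atTop n] with m hm
    exact hanti hm (mem_of_mem_nhds (hf m).2.2.2)
  have hzT : z ∈ T := by
    rw [hTO]
    exact mem_iInter.2 fun n => (hfr n).2.1 (hzF (n + 1))
  have hθlim : Tendsto (fun n => θ (f n).1) atTop (𝓝 (θ z)) :=
    ((hDθ.mono fun x hx => (hTsub hx).1) z hzT).tendsto.comp
      (tendsto_nhdsWithin_iff.2 ⟨hlim, .of_forall fun n => hCT (hf n).1⟩)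
  obtain ⟨g, hg⟩ := cauchySeq_tendsto_of_complete (cauchySeq_of_le_geometric (1 / 2 : ℝ) 1
    (by norm_num) (f := fun n => (f n).2.1) fun n => by simpa using (hfr n).2.2.1.le)
  have hzg : θ z = g • θ x₀ := by
    refine tendsto_nhds_unique hθlim ?_
    simp only [(hf _).2.1]
    exact hg.smul_const _
  -- One common coordinate suffices for the contradiction: z k was set at step k to a value other
  -- than x₀ k.
  obtain ⟨k, hk⟩ := ((hred x₀ z).2 ⟨g, hzg⟩).exists
  refine (hfr k).2.2.2.1 ?_
  rw [hinit k k le_rfl]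
  exact hk.symm

end EventualEquality

/-! ### Continuous functions on the real line -/

section RealFunctions

instance : BaireSpace C(ℝ, ℝ) := by
  have : (𝓤 C(ℝ, ℝ)).IsCountablyGenerated := inferInstance
  infer_instance

theorem finiteDistRel_supMetric_iff {f g : C(ℝ, ℝ)} :
    supMetric.finiteDistRel f g ↔ ∃ K : ℝ, ∀ t, |f t - g t| ≤ K := by
  change (⨆ t : ℝ, ENNReal.ofReal |f t - g t|) < ∞ ↔ _
  constructor
  · intro h
    exact ⟨_, fun t => (ENNReal.ofReal_le_iff_le_toReal h.ne).1
      (le_iSup (fun t : ℝ => ENNReal.ofReal |f t - g t|) t)⟩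
  · rintro ⟨K, hK⟩
    exact (iSup_le fun t => ENNReal.ofReal_le_ofReal (hK t)).trans_lt ENNReal.ofReal_lt_top

/-- The restriction to `ℝ` of continuous functions on the extended real line. -/
noncomputable def restrictReal : C(EReal, ℝ) →L[ℝ] C(ℝ, ℝ) where
  toFun h := h.comp ⟨Real.toEReal, continuous_coe_real_ereal⟩
  map_add' _ _ := rfl
  map_smul' _ _ := rfl
  cont := ContinuousMap.continuous_precomp _

theorem finiteDistRel_add_restrictReal (f : C(ℝ, ℝ)) (h : C(EReal, ℝ)) :
    supMetric.finiteDistRel f (f + restrictReal h) := by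
  refine finiteDistRel_supMetric_iff.2 ⟨‖h‖, fun t => ?_⟩
  have : f t - (f + restrictReal h) t = -h (t : EReal) := by
    simp [restrictReal]
  rw [this, abs_neg]
  exact h.norm_coe_le_norm _

/-- Functions that agree with `f` on `[-n, n]` converge to `f`. -/
theorem ContinuousMap.tendsto_of_eqOn_Icc {E : Type*} [TopologicalSpace E] {F : ℕ → C(ℝ, E)}
    {f : C(ℝ, E)} (h : ∀ n : ℕ, EqOn (F n) f (Icc (-n) n)) : Tendsto F atTop (𝓝 f) := by
  refine ContinuousMap.tendsto_nhds_compactOpen.2 fun K hK U hU hf => ?_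
  obtain ⟨r, hr⟩ := hK.isBounded.subset_closedBall 0
  filter_upwards [eventually_ge_atTop ⌈r⌉₊] with n hn t ht
  have hrn : r ≤ n := Nat.ceil_le.1 hn
  have h1 := hr ht
  rw [Real.closedBall_eq_Icc] at h1
  rw [h n ⟨by linarith [h1.1], by linarith [h1.2]⟩]
  exact hf ht

/-- By Tietze, the restriction of f to [-n, n], a closed subset of the extended line, extends to the
whole extended line; these extensions converge to f uniformly on compact sets. -/
theorem denseRange_restrictReal : DenseRange restrictReal := by
  intro f
  have hext : ∀ n : ℕ, ∃ h : C(EReal, ℝ), EqOn (restrictReal h) f (Icc (-n) n) := by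
    intro n
    have he : IsClosedEmbedding fun t : Icc (-n : ℝ) n => ((t : ℝ) : EReal) :=
      Continuous.isClosedEmbedding
        (continuous_coe_real_ereal.comp continuous_subtype_val) fun s t hst =>
        Subtype.ext (EReal.coe_injective hst)
    obtain ⟨h, hh⟩ := (f.restrict (Icc (-n : ℝ) n)).exists_extension he
    exact ⟨h, fun t ht => DFunLike.congr_fun hh ⟨t, ht⟩⟩
  choose h hh using hext
  exact mem_closure_of_tendsto (ContinuousMap.tendsto_of_eqOn_Icc hh)
    (.of_forall fun n => mem_range_self _)

theorem dense_finiteDistRel_supMetric (f : C(ℝ, ℝ)) : Dense {g | supMetric.finiteDistRel f g} := by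
  have h : DenseRange fun h => f + restrictReal h :=
    (Homeomorph.addLeft f).surjective.denseRange.comp denseRange_restrictReal
      (Homeomorph.addLeft f).continuous
  refine h.mono ?_
  rintro _ ⟨h, rfl⟩
  exact finiteDistRel_add_restrictReal f h

theorem isMeagre_finiteDistRel_supMetric (f : C(ℝ, ℝ)) :
    IsMeagre {g | supMetric.finiteDistRel f g} := by
  have hclosed : ∀ n : ℕ, IsClosed {g : C(ℝ, ℝ) | ∀ t, |f t - g t| ≤ n} := fun n => by
    simp only [ofPred_forall]
    exact isClosed_iInter fun t => isClosed_le
      (continuous_const.sub (ContinuousEvalConst.continuous_eval_const t)).abs continuous_const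
  have hint : ∀ n : ℕ, interior {g : C(ℝ, ℝ) | ∀ t, |f t - g t| ≤ n} = ∅ := by
    intro n
    by_contra hne
    obtain ⟨g, hg⟩ := nonempty_iff_ne_empty.2 hne
    -- These perturbations tend to g, yet each is unboundedly far from it. At N + (2n + 1) the gap
    -- is 2n + 1, too large for two functions within n of f.
    let F : ℕ → C(ℝ, ℝ) := fun N => g + ⟨fun t => max 0 (t - N), by fun_prop⟩
    have hF : Tendsto F atTop (𝓝 g) := ContinuousMap.tendsto_of_eqOn_Icc fun N t ht => by
      simp [F, ht.2]
    obtain ⟨N, hN⟩ := (hF.eventually (isOpen_interior.mem_nhds hg)).exists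
    have h1 := interior_subset hg (N + (2 * n + 1))
    have h2 := interior_subset hN (N + (2 * n + 1))
    have h3 : F N (N + (2 * n + 1)) = g (N + (2 * n + 1)) + (2 * n + 1) := by
      have : (0 : ℝ) ≤ 2 * n + 1 := by positivity
      simp [F, this]
    rw [h3, abs_le] at h2
    rw [abs_le] at h1
    linarith [h1.2, h2.1]
  refine (isMeagre_iUnion fun n : ℕ => IsNowhereDense.isMeagre
    ((hclosed n).isNowhereDense_iff.2 (hint n))).mono fun g hg => ?_
  obtain ⟨K, hK⟩ := finiteDistRel_supMetric_iff.1 hg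
  obtain ⟨n, hn⟩ := exists_nat_ge K
  exact mem_iUnion.2 ⟨n, fun t => (hK t).trans hn⟩

/-- Local equivalence classes contain the trace of an equivalence class on a neighbourhood. -/
theorem exists_subset_localClass_supMetric {U : Set C(ℝ, ℝ)} (hU : IsOpen U)
    {V : Set (C(ℝ, ℝ) × C(ℝ, ℝ))} (hV : V ∈ 𝓤[supMetric.toUniformRelation.uniformity])
    {f : C(ℝ, ℝ)} (hf : f ∈ U) :
    ∃ O, IsOpen O ∧ f ∈ O ∧ O ∩ {g | supMetric.finiteDistRel f g} ⊆ localClass V U f := by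
  obtain ⟨S, ⟨hS, hSc⟩, hSU⟩ :=
    (LocallyConvexSpace.convex_basis (𝕜 := ℝ) f).mem_iff.1 (hU.mem_nhds hf)
  refine ⟨interior S, isOpen_interior, mem_interior_iff_mem_nhds.2 hS, ?_⟩
  rintro g ⟨hgS, hfg⟩
  obtain ⟨ε, hε, hεV⟩ := (@mem_uniformity_edist _ supMetric.toPseudoEMetricSpace _).1 hV
  obtain ⟨K, hK⟩ := finiteDistRel_supMetric_iff.1 hfg
  -- ε may be infinite, so a positive real δ below it bounds the step length; K / δ < N makes K / (N
  -- + 1) at most δ.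
  obtain ⟨δ, -, hδ, hδε⟩ := ENNReal.lt_iff_exists_real_btwn.1 hε
  have hδ' : 0 < δ := ENNReal.ofReal_pos.1 hδ
  obtain ⟨N, hN⟩ := exists_nat_gt (K / δ)
  have hpos : (0 : ℝ) < N + 1 := by positivity
  have hseg : ∀ j : ℕ, j ≤ N + 1 → f + ((j : ℝ) * (N + 1 : ℝ)⁻¹) • (g - f) ∈ U := by
    intro j hj
    refine hSU (hSc.add_smul_sub_mem (mem_of_mem_nhds hS) (interior_subset hgS)
      ⟨by positivity, ?_⟩)
    rw [mul_inv_le_iff₀ hpos, one_mul]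
    exact_mod_cast hj
  have hind : ∀ j : ℕ, j ≤ N + 1 →
      f + ((j : ℝ) * (N + 1 : ℝ)⁻¹) • (g - f) ∈ localClass V U f := by
    intro j
    induction j with
    | zero =>
      intro _
      have h0 : f ∈ localClass V U f := Relation.ReflTransGen.refl
      simpa only [Nat.cast_zero, zero_mul, zero_smul, add_zero] using h0
    | succ j ih =>
      intro hj
      refine (ih (by omega)).tail ⟨hεV ?_, hseg _ (by omega), hseg _ hj⟩
      refine lt_of_le_of_lt (iSup_le fun t => ENNReal.ofReal_le_ofReal ?_) hδε
      have h1 : (f + ((j : ℝ) * (N + 1 : ℝ)⁻¹) • (g - f)) t -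
          (f + (((j + 1 : ℕ) : ℝ) * (N + 1 : ℝ)⁻¹) • (g - f)) t =
          (f t - g t) * (N + 1 : ℝ)⁻¹ := by
        simp only [ContinuousMap.add_apply, ContinuousMap.smul_apply, ContinuousMap.sub_apply,
          smul_eq_mul]
        push_cast
        ring
      rw [h1, abs_mul, abs_of_pos (inv_pos.2 hpos), mul_inv_le_iff₀ hpos]
      rw [div_lt_iff₀ hδ'] at hN
      nlinarith [hK t]
  have hfin := hind (N + 1) le_rfl
  have h1 : (((N + 1 : ℕ) : ℝ) * (N + 1 : ℝ)⁻¹) = 1 := by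
    push_cast
    exact mul_inv_cancel₀ hpos.ne'
  rwa [h1, one_smul, add_sub_cancel] at hfin

theorem isTurbulent_supMetric : supMetric.toUniformRelation.IsTurbulent where
  dense_class := dense_finiteDistRel_supMetric
  meagre_class := isMeagre_finiteDistRel_supMetric
  somewhere_dense_localClass U V hU hV _ f hf := by
    obtain ⟨O, hO, hfO, hOsub⟩ := exists_subset_localClass_supMetric hU hV hf
    exact ⟨f, interior_maximal (((dense_finiteDistRel_supMetric f).open_subset_closure_inter
      hO).trans (closure_mono hOsub)) hO hfO⟩

/-- A sequence of continuous real functions on `X` can be encoded as a continuous map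
`X → C(ℝ, ℝ)`, by means of disjoint bumps around the natural numbers. -/
theorem exists_continuousMap_disjoint_bumps {X : Type*} [TopologicalSpace X] {c : ℕ → X → ℝ}
    (hc : ∀ i, Continuous (c i)) :
    ∃ Φ : C(X, C(ℝ, ℝ)), (∀ (i : ℕ) x, Φ x i = c i x) ∧
      ∀ t, ∃ i, ∃ b ∈ Icc (0 : ℝ) 1, ∀ x, Φ x t = c i x * b := by
  -- The bump at i lives on |t - i| < 1/2, so at most one bump is nonzero at any t.
  set b : ℕ → ℝ → ℝ := fun i t => max 0 (1 - 2 * |t - i|) with hb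
  have hb0 : ∀ (i : ℕ) (t : ℝ), 1 / 2 ≤ |t - i| → b i t = 0 := fun i t h =>
    max_eq_left (by linarith)
  have hb1 : ∀ i : ℕ, b i i = 1 := fun i => by simp [hb]
  have hbI : ∀ i t, b i t ∈ Icc (0 : ℝ) 1 := fun i t =>
    ⟨le_max_left _ _, max_le zero_le_one (by linarith [abs_nonneg (t - i)])⟩
  have huniq : ∀ i j : ℕ, ∀ t : ℝ, |t - i| < 1 / 2 → j ≠ i → b j t = 0 := by
    intro i j t hi hj
    refine hb0 j t ?_
    by_contra! hcon
    apply hj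
    have h1 : |(j : ℝ) - i| < 1 := by
      rw [abs_lt] at *
      constructor <;> linarith [hi.1, hi.2, hcon.1, hcon.2]
    have h2 : |(j : ℤ) - i| < 1 := by exact_mod_cast h1
    have := Int.abs_lt_one_iff.1 h2
    omega
  have hloc : LocallyFinite fun i => Function.support fun p : X × ℝ => c i p.1 * b i p.2 := by
    rintro ⟨x, t⟩
    refine ⟨univ ×ˢ Metric.ball t 1, prod_mem_nhds univ_mem (Metric.ball_mem_nhds _ one_pos),
      (finite_Iic ⌈t + 2⌉₊).subset ?_⟩
    rintro i ⟨⟨y, s⟩, hys, -, hs⟩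
    have h1 : |s - i| < 1 / 2 := by
      by_contra! h
      exact hys (by simp [hb0 i s h])
    rw [Metric.mem_ball, Real.dist_eq] at hs
    rw [abs_lt] at h1 hs
    have h2 : (i : ℝ) ≤ ⌈t + 2⌉₊ := by linarith [Nat.le_ceil (t + 2), h1.1, hs.2]
    exact_mod_cast h2
  have hcont : Continuous fun p : X × ℝ => ∑ᶠ i, c i p.1 * b i p.2 :=
    continuous_finsum (fun i => by have := hc i; fun_prop) hloc
  have hsingle : ∀ (i : ℕ) (t : ℝ) (x : X), |t - i| < 1 / 2 →
      ∑ᶠ j, c j x * b j t = c i x * b i t := fun i t x h =>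
    finsum_eq_single _ i fun j hj => by rw [huniq i j t h hj, mul_zero]
  refine ⟨ContinuousMap.curry ⟨_, hcont⟩, fun i x => ?_, fun t => ?_⟩
  · change ∑ᶠ j, c j x * b j i = c i x
    rw [hsingle i i x (by simp), hb1, mul_one]
  · by_cases h : ∃ i : ℕ, |t - i| < 1 / 2
    · obtain ⟨i, hi⟩ := h
      exact ⟨i, b i t, hbI i t, fun x => hsingle i t x hi⟩
    · push Not at h
      -- Off all the bumps the value is 0, expressed as the coefficient 0 of an arbitrary index.
      refine ⟨0, 0, ⟨le_rfl, zero_le_one⟩, fun x => ?_⟩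
      change ∑ᶠ j, c j x * b j t = _
      simp [hb0 _ t (h _)]

/-- Eventual equality of real sequences continuously reduces to bounded distance of continuous
functions. -/
theorem exists_continuousMap_eventuallyEq_iff_finiteDistRel :
    ∃ Φ : C(ℕ → ℝ, C(ℝ, ℝ)), ∀ x y : ℕ → ℝ,
      x =ᶠ[atTop] y ↔ supMetric.finiteDistRel (Φ x) (Φ y) := by
  obtain ⟨e, he⟩ := exists_surjective_nat (ℕ × ℚ × ℕ)
  -- The index (m, q, k) carries min (m + 1, k |x m - q|). The cap bounds the effect of each single
  -- coordinate, while the scale k magnifies any difference in coordinate m to a gap of at least m.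
  obtain ⟨Φ, hΦ, hΦb⟩ := exists_continuousMap_disjoint_bumps
    (c := fun i (x : ℕ → ℝ) => min ((e i).1 + 1 : ℝ) ((e i).2.2 * |x (e i).1 - (e i).2.1|))
    fun i => by fun_prop
  refine ⟨Φ, fun x y => ?_⟩
  rw [finiteDistRel_supMetric_iff]
  constructor
  · intro hxy
    obtain ⟨n, hn⟩ := eventually_atTop.1 hxy
    refine ⟨n, fun t => ?_⟩
    obtain ⟨i, b, ⟨hb0, hb1⟩, hb⟩ := hΦb t
    rw [hb, hb, ← sub_mul, abs_mul, abs_of_nonneg hb0]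
    refine (mul_le_of_le_one_right (abs_nonneg _) hb1).trans ?_
    rcases le_or_gt n (e i).1 with h | h
    · simp [hn _ h]
    · have h' : ((e i).1 + 1 : ℝ) ≤ n := by exact_mod_cast h
      have hm : ∀ z : ℕ → ℝ,
          min ((e i).1 + 1 : ℝ) ((e i).2.2 * |z (e i).1 - (e i).2.1|) ∈ Icc (0 : ℝ) n := fun z =>
        ⟨le_min (by positivity) (by positivity), (min_le_left _ _).trans h'⟩
      exact (abs_sub_le_of_nonneg_of_le (hm x).1 (hm x).2 (hm y).1 (hm y).2)
  · rintro ⟨K, hK⟩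
    obtain ⟨n, hn⟩ := exists_nat_gt K
    filter_upwards [eventually_ge_atTop (n + 1)] with m hm
    by_contra hne
    have hd : 0 < |x m - y m| := abs_pos.2 (sub_ne_zero.2 hne)
    -- With q within 1/k of x m, the term for x is at most 1. The m + 2 leaves k |y m - q| at least
    -- m + 1, so the term for y reaches the cap and the gap is at least m.
    obtain ⟨k, hk⟩ := exists_nat_gt ((m + 2) / |x m - y m|)
    rw [div_lt_iff₀ hd] at hk
    have hk0 : (0 : ℝ) < k := by
      by_contra! h
      nlinarith [(Nat.cast_nonneg m : (0 : ℝ) ≤ m)]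
    obtain ⟨q, hq1, hq2⟩ := exists_rat_btwn (show x m < x m + (k : ℝ)⁻¹ by
      linarith [inv_pos.2 hk0])
    have hq : k * |x m - q| ≤ 1 := by
      rw [← le_div_iff₀' hk0, one_div, abs_le]
      constructor <;> linarith [inv_pos.2 hk0]
    have hyq : (m + 1 : ℝ) ≤ k * |y m - q| := by
      have := abs_sub_le (x m) q (y m)
      rw [abs_sub_comm (q : ℝ)] at this
      nlinarith
    obtain ⟨i, hi⟩ := he (m, q, k)
    have h := hK i
    rw [hΦ, hΦ, hi] at h
    dsimp only at h
    rw [min_eq_left hyq] at h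
    have h1 := (min_le_right (m + 1 : ℝ) (k * |x m - q|)).trans hq
    have h2 := (abs_le.1 h).1
    have h3 : ((n + 1 : ℕ) : ℝ) ≤ m := by exact_mod_cast hm
    push_cast at h3
    linarith

end RealFunctions

theorem theoremt :
    supMetric.toUniformRelation.IsTurbulent ∧
    (∀ (Y : Type*) [TopologicalSpace Y] [PolishSpace Y] [MulAction SInfty Y]
        [ContinuousSMul SInfty Y],
      GenericallyErgodic supMetric.finiteDistRel (MulAction.orbitRel SInfty Y)) ∧
    (∀ (G : Type*) [Group G] [TopologicalSpace G] [IsTopologicalGroup G] [PolishSpace G]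
        (Y : Type*) [TopologicalSpace Y] [PolishSpace Y] [MulAction G Y] [ContinuousSMul G Y],
      ¬ BorelReducible supMetric.finiteDistRel (MulAction.orbitRel G Y)) := by
  refine ⟨isTurbulent_supMetric, ?_, ?_⟩
  · intro Y _ _ _ _ θ hinv hθ
    obtain ⟨C, hC, hCθ⟩ := exists_residual_forall_exists_smul (G := SInfty) restrictReal
      denseRange_restrictReal hθ fun f h => by
        -- `MulAction.orbitRel` relates a to b when a lies in the orbit of b, hence the symmetry.
        obtain ⟨g, hg⟩ := (MulAction.orbitRel SInfty Y).symm
          (hinv _ _ (finiteDistRel_add_restrictReal f h))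
        exact ⟨g, hg.symm⟩
    -- The saturation of C stays residual, and invariance of θ keeps its image in the same orbit.
    refine ⟨{f | ∃ c ∈ C, supMetric.finiteDistRel c f},
      mem_of_superset hC fun c hc => ⟨c, hc, supMetric.finiteDistRel.refl c⟩, ?_, ?_⟩
    · rintro f ⟨c, hc, hcf⟩ f' hff'
      exact ⟨c, hc, supMetric.finiteDistRel.trans hcf hff'⟩
    · rintro f ⟨c, hc, hcf⟩ f' ⟨c', hc', hcf'⟩
      obtain ⟨g, hg⟩ := hCθ c' hc' c hc
      have h1 : (MulAction.orbitRel SInfty Y) (θ c) (θ c') := ⟨g, hg.symm⟩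
      exact (MulAction.orbitRel SInfty Y).trans
        ((MulAction.orbitRel SInfty Y).symm (hinv _ _ hcf))
        ((MulAction.orbitRel SInfty Y).trans h1 (hinv _ _ hcf'))
  · rintro G _ _ _ _ Y _ _ _ _ ⟨θ, hθ, hinv, hinj⟩
    obtain ⟨Φ, hΦ⟩ := exists_continuousMap_eventuallyEq_iff_finiteDistRel
    have hΦθ : IsBorelMap (θ ∘ Φ) := by
      borelize (ℕ → ℝ) C(ℝ, ℝ) Y
      have hθ' : Measurable θ := hθ
      exact hθ'.comp Φ.continuous.measurable
    refine hΦθ.isBaireMeasurableMap.not_forall_eventuallyEq_iff_exists_smul (G := G)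
      fun x y => (hΦ x y).trans ⟨fun h => ?_, ?_⟩
    · obtain ⟨g, hg⟩ := (MulAction.orbitRel G Y).symm (hinv _ _ h)
      exact ⟨g, hg.symm⟩
    · rintro ⟨g, hg⟩
      have h1 : (MulAction.orbitRel G Y) (θ (Φ y)) (θ (Φ x)) := ⟨g, hg.symm⟩
      exact Quotient.exact (s := supMetric.finiteDistRel)
        (@hinj ⟦Φ x⟧ ⟦Φ y⟧ (Quotient.sound (s := MulAction.orbitRel G Y)
          ((MulAction.orbitRel G Y).symm h1)))
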